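/- Let $d\ge 2$ be an integer and let $q\in(1,2)\cup(2,\infty)$; equip $\mathbb{R}^d$ with the norm $\|x\|_q=(\sum_{i=1}^d|x_i|^q)^{1/q}$. A placement of a finite simple graph $G$ is a map $p:V(G)\to\mathbb{R}^d$ with $p_v\neq p_w$ for every edge $vw$. An infinitesimal flex of $(G,p)$ is a map $u:V(G)\to\mathbb{R}^d$ with $\|(p_v+tu_v)-(p_w+tu_w)\|_q-\|p_v-p_w\|_q=o(t)$ as $t\to0$ for every edge $vw$. It is trivial if $u_v=\gamma(p_v)$ for all $v$, where $\gamma(x)=\frac{d}{dt}\Gamma(x,t)|_{t=0}$ for some $\Gamma:\mathbb{R}^d\times[-1,1]\to\mathbb{R}^d$ that is isometric in $x$, continuous in $t$, satisfies $\Gamma(x,0)=x$, and is differentiable in $t$ at $t=0$ for every $x$. The placement $p$ is infinitesimally rigid if every infinitesimal flex of $(G,p)$ is trivial. The rigidity matrix $R_q(G,p)$ has one row for each edge $vw$, with entries $\operatorname{sgn}(p_{v,i}-p_{w,i})|p_{v,i}-p_{w,i}|^{q-1}$ in the columns $(v,i)$, their negatives in the columns $(w,i)$, and $0$ elsewhere.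 A placement $p$ of $G$ is regular if it maximises $\operatorname{rank}R_q(G,\cdot)$ over all placements of $G$, and generic if $p$ is injective and, for every subgraph $H$ of the complete graph on $V(G)$, the restriction of $p$ to $V(H)$ is a regular placement of $H$. The graph $G$ is rigid in $(\mathbb{R}^d,\|\cdot\|_q)$ if its generic placements are infinitesimally rigid; this is understood non-vacuously, that is, $G$ is also required to have at least one infinitesimally rigid placement. A finite multi-body graph for $(\mathbb{R}^d,\|\cdot\|_q)$ is a finite simple graph $G$ with at least one vertex, together with a partition of $V(G)$ into non-empty sets $V_1,\dots,V_n$ such that each subgraph induced by $V_k$ (a body) is rigid in $(\mathbb{R}^d,\|\cdot\|_q)$ and each vertex in $V_k$ is adjacent to at most one vertex outside $V_k$. Its body-bar graph $G_b$ is the multigraph whose vertices are the bodies and whose edges are the inter-body edges of $G$ (the edges with ends in two different bodies), each joining the two bodies that contain its ends. A finite multigraph $M$ is $(d,d)$-sparse if $|E(H)|\le d|V(H)|-d$ for every subgraph $H$ of $M$ with at least two vertices, and $(d,d)$-tight if moreover $|E(M)|=d|V(M)|-d$. **Theorem.** Let $G$ be a finite multi-body graph for $(\mathbb{R}^d,\|\cdot\|_q)$.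 Then the following statements are equivalent. 1. $G$ is rigid in $(\mathbb{R}^d,\|\cdot\|_q)$. 2. $G_b$ has a $(d,d)$-tight spanning subgraph. -/

import Mathlib

open Filter Topology Asymptotics

noncomputable section

/-! ### Bar-joint frameworks in a normed space -/

section Frameworks

variable {X : Type*} [NormedAddCommGroup X] [NormedSpace ℝ X] {V : Type*}

/-- `p` is a placement of the simple graph `G` in `X`. -/
def IsPlacement (G : SimpleGraph V) (p : V → X) : Prop :=
  ∀ ⦃v w : V⦄, G.Adj v w → p v ≠ p w

/-- An infinitesimal flex of the framework `(G, p)`. -/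
def IsInfinitesimalFlex (G : SimpleGraph V) (p u : V → X) : Prop :=
  ∀ ⦃v w : V⦄, G.Adj v w →
    (fun t : ℝ => ‖(p v + t • u v) - (p w + t • u w)‖ - ‖p v - p w‖) =o[𝓝 0] fun t : ℝ => t

/-- A continuous rigid motion of `X`, with time parameter in `[-1, 1]`. -/
structure IsContinuousRigidMotion (Γ : X → ℝ → X) : Prop where
  isometry : ∀ t ∈ Set.Icc (-1 : ℝ) 1, Isometry fun x => Γ x t
  continuousOn : ∀ x, ContinuousOn (Γ x) (Set.Icc (-1 : ℝ) 1)
  initial : ∀ x, Γ x 0 = x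

/-- An infinitesimal rigid motion of `X`: the velocity field at time `0` of a continuous rigid
motion. -/
def IsInfinitesimalRigidMotion (γ : X → X) : Prop :=
  ∃ Γ : X → ℝ → X, IsContinuousRigidMotion Γ ∧ ∀ x, HasDerivAt (Γ x) (γ x) 0

/-- The framework `(G, p)` is infinitesimally rigid: `p` is a placement and every infinitesimal
flex is trivial, that is, the restriction of an infinitesimal rigid motion of `X`. -/
def IsInfinitesimallyRigid (G : SimpleGraph V) (p : V → X) : Prop :=
  IsPlacement G p ∧
    ∀ u : V → X, IsInfinitesimalFlex G p u →
      ∃ γ : X → X, IsInfinitesimalRigidMotion γ ∧ ∀ v, u v = γ (p v)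

end Frameworks

/-! ### The spaces `(ℝ^d, ‖·‖_q)`, rigidity matrices and generic placements -/

/-- `ℝ^d` with the `ℓ^q` norm. -/
abbrev LqSpace (d : ℕ) (q : ENNReal) : Type := PiLp q fun _ : Fin d => ℝ

section Lq

variable {V : Type*} {d : ℕ} {q : ENNReal}

open Classical in
/-- The rigidity matrix `R_q(G, p)`: in the row of the edge `vw` the block of columns of `v` is the
vector with coordinates `sgn(p_{v,i} - p_{w,i}) |p_{v,i} - p_{w,i}|^(q-1)`, the block of `w` is its
negative, and all other entries are zero. (The ends of an edge are put in an arbitrary order, which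
does not change the row.) -/
def rigidityMatrix (G : SimpleGraph V) (p : V → LqSpace d q) :
    Matrix G.edgeSet (V × Fin d) ℝ := fun e c =>
  let v := (Quot.out (e : Sym2 V)).1
  let w := (Quot.out (e : Sym2 V)).2
  let a := SignType.sign (p v c.2 - p w c.2) * |p v c.2 - p w c.2| ^ (q.toReal - 1)
  if c.1 = v then a else if c.1 = w then -a else 0

/-- `(G, p)` is regular: `p` is a placement at which the rank of the rigidity matrix attains its
maximum over all placements of `G`. -/
def IsRegularPlacement (G : SimpleGraph V) (p : V → LqSpace d q) : Prop :=
  IsPlacement G p ∧ ∀ x : V → LqSpace d q, IsPlacement G x →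
    (rigidityMatrix G x).eRank ≤ (rigidityMatrix G p).eRank

/-- A placement of a graph with vertex set `V` is generic if it is a placement of the complete
graph on `V` and every subframework of the complete framework is regular. -/
def IsGenericPlacement (p : V → LqSpace d q) : Prop :=
  IsPlacement (⊤ : SimpleGraph V) p ∧
    ∀ H : (⊤ : SimpleGraph V).Subgraph, IsRegularPlacement H.coe fun v => p v

/-- `G` is rigid in `(ℝ^d, ‖·‖_q)`: its generic placements are infinitesimally rigid. The first
conjunct keeps the definition from being satisfied vacuously; for a finite graph and finite `q > 1`,
`q ≠ 2`, it implies the second one, because a regular placement has the largest possible rank. -/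
def IsRigid (d : ℕ) (q : ENNReal) [Fact (1 ≤ q)] (G : SimpleGraph V) : Prop :=
  (∃ p : V → LqSpace d q, IsInfinitesimallyRigid G p) ∧
    ∀ p : V → LqSpace d q, IsGenericPlacement p → IsInfinitesimallyRigid G p

end Lq

/-! ### Multi-body graphs, body-bar graphs and sparsity -/

section MultiBody

variable {V : Type*}

/-- `G` is a multi-body graph for `(ℝ^d, ‖·‖_q)` with respect to the partition of its vertex set
into the classes of `s`: every class induces a rigid graph (a body), and every vertex is adjacent
to at most one vertex outside its own body. -/
structure IsMultiBody (d : ℕ) (q : ENNReal) [Fact (1 ≤ q)] (G : SimpleGraph V) (s : Setoid V) :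
    Prop where
  body_isRigid : ∀ k : Quotient s, IsRigid d q (G.induce {v | Quotient.mk s v = k})
  adj_unique : ∀ ⦃v w w' : V⦄, G.Adj v w → ¬ s v w → G.Adj v w' → ¬ s v w' → w = w'

/-- The body-bar graph of `G`: the multigraph whose vertices are all the bodies and whose edges are
the inter-body edges of `G`, each joining the two bodies that contain its ends. -/
def bodyBarGraph (G : SimpleGraph V) (s : Setoid V) : Graph (Quotient s) (Sym2 V) where
  vertexSet := Set.univ
  IsLink e x y := ∃ v w : V, e = s(v, w) ∧ G.Adj v w ∧ ¬ s v w ∧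
    x = Quotient.mk s v ∧ y = Quotient.mk s w
  isLink_symm := by
    intro e _
    refine ⟨?_⟩
    rintro x y ⟨v, w, rfl, h, hs, rfl, rfl⟩
    exact ⟨w, v, Sym2.eq_swap, h.symm, fun h' => hs (Setoid.symm' s h'), rfl, rfl⟩
  eq_or_eq_of_isLink_of_isLink := by
    rintro e x y x' y' ⟨v, w, rfl, -, -, rfl, rfl⟩ ⟨v', w', h, -, -, rfl, rfl⟩
    rcases Sym2.eq_iff.1 h with ⟨rfl, rfl⟩ | ⟨rfl, rfl⟩
    · exact Or.inl rfl
    · exact Or.inr rfl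
  left_mem_of_isLink := fun _ _ _ _ => Set.mem_univ _

/-- A finite multigraph is `(k, l)`-sparse if `|E(H)| ≤ k |V(H)| - l` for every subgraph `H` with at
least two vertices. -/
def IsSparse {α β : Type*} [Finite α] [Finite β] (k l : ℕ) (M : Graph α β) : Prop :=
  ∀ H : Graph α β, H ≤ M → 2 ≤ H.vertexSet.ncard →
    (H.edgeSet.ncard : ℤ) ≤ (k : ℤ) * H.vertexSet.ncard - l

/-- A finite multigraph is `(k, l)`-tight if it is `(k, l)`-sparse and `|E| = k |V| - l`. -/
def IsTight {α β : Type*} [Finite α] [Finite β] (k l : ℕ) (M : Graph α β) : Prop :=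
  IsSparse k l M ∧ (M.edgeSet.ncard : ℤ) = (k : ℤ) * M.vertexSet.ncard - l

end MultiBody

end

/-!
For `q ≠ 2` the only infinitesimal rigid motions of `ℓ^q` are the translations
(`IsInfinitesimalRigidMotion.eq_const`), and the equation that an edge `vw` imposes on a flex `u` is
`b ⬝ (u v - u w) = 0`, where `b` is the coordinatewise signed power `sgn(x) |x|^(q - 1)` of
`p v - p w`. Hence a placement is infinitesimally rigid iff this linear system has constant
solutions only, which is a condition on the rank. In particular one infinitesimally rigid placement
makes every regular placement infinitesimally rigid (`isRigid_iff_exists`), and infinitesimal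
rigidity is an open condition (`IsInfinitesimallyRigid.eventually`).

If a multi-body graph is rigid, then a flex that is constant on every body only has to satisfy the
equations of the bars, so the rows of the bars, as vectors indexed by bodies and coordinates, have
rank `d |B| - d` with `B` the set of bodies. A basis chosen among them is a `(d, d)`-tight
subgraph: independent rows supported on a set `C` of bodies are annihilated by the constants, so
there are at most `d |C| - d` of them (`LinearIndependent.card_bars_le`).

For the converse, let the bars of `H` form a tight spanning subgraph. Sparsity is exactly what
Rado's theorem on independent transversals (`exists_linearIndependent_transversal`) needs in order
to choose, for each bar, a coefficient vector from a prescribed spanning subset of `ℝ^d` in such a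
way that the rows become independent (`exists_linearIndependent_barRow`); there are `d |B| - d` of
them, so the bars then fix the bodies relative to each other. Now start with arbitrary rigid
placements of the bodies. As no vertex is an end of two bars, the vectors `p v - p w` of the bars
may be varied independently of each other in small open sets without destroying the rigidity of the
bodies, and the signed powers of the points of an open set span `ℝ^d`
(`span_signedPow_image_eq_top`). So the choice required by Rado's theorem is available.
-/

noncomputable section

/-! ### Signed powers and the derivative of the `ℓ^q` norm -/

/-- The signed power `sgn(x) |x|^r`; with `r = q - 1` it gives the entries of the rigidity
matrix. -/
def signedPow (r x : ℝ) : ℝ := SignType.sign x * |x| ^ r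

lemma signedPow_neg (r x : ℝ) : signedPow r (-x) = -signedPow r x := by
  simp [signedPow, Left.sign_neg]

lemma signedPow_zero (r : ℝ) : signedPow r 0 = 0 := by simp [signedPow]

lemma signedPow_of_pos (r : ℝ) {x : ℝ} (hx : 0 < x) : signedPow r x = x ^ r := by
  simp [signedPow, sign_pos hx, abs_of_pos hx]

lemma signedPow_of_nonneg {r x : ℝ} (hr : 0 < r) (hx : 0 ≤ x) : signedPow r x = x ^ r := by
  rcases hx.eq_or_lt with rfl | hx
  · rw [signedPow_zero, Real.zero_rpow hr.ne']
  · exact signedPow_of_pos r hx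

lemma strictMono_signedPow {r : ℝ} (hr : 0 < r) : StrictMono (signedPow r) := by
  refine strictMono_of_odd_strictMonoOn_nonneg (signedPow_neg r) fun x hx y hy hxy => ?_
  rw [signedPow_of_nonneg hr hx, signedPow_of_nonneg hr hy]
  exact Real.rpow_lt_rpow hx hxy hr

lemma continuous_signedPow {r : ℝ} (hr : 0 < r) : Continuous (signedPow r) := by
  have h : signedPow r = fun x => max x 0 ^ r - max (-x) 0 ^ r := by
    funext x
    rcases le_total 0 x with hx | hx
    · rw [signedPow_of_nonneg hr hx, max_eq_left hx, max_eq_right (by linarith),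
        Real.zero_rpow hr.ne', sub_zero]
    · rw [← neg_neg (signedPow r x), ← signedPow_neg, signedPow_of_nonneg hr (by linarith),
        max_eq_right hx, max_eq_left (by linarith), Real.zero_rpow hr.ne', zero_sub]
  rw [h]
  have h0 : ∀ x : ℝ, x ≠ 0 ∨ 0 ≤ r := fun _ => Or.inr hr.le
  exact ((continuous_id.max continuous_const).rpow_const fun _ => h0 _).sub
    ((continuous_neg.max continuous_const).rpow_const fun _ => h0 _)

lemma hasDerivAt_abs_rpow_signedPow (x : ℝ) {r : ℝ} (hr : 0 < r) :
    HasDerivAt (fun y : ℝ => |y| ^ (r + 1)) ((r + 1) * signedPow r x) x := by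
  convert hasDerivAt_abs_rpow x (p := r + 1) (by linarith) using 1
  rcases eq_or_ne x 0 with rfl | hx
  · simp [signedPow_zero]
  · rw [signedPow, mul_assoc]
    congr 1
    nth_rewrite 4 [← sign_mul_abs x]
    rw [mul_left_comm, ← Real.rpow_add_one (abs_ne_zero.2 hx)]
    congr 2
    ring

section Flexes

variable {d : ℕ} {q : ENNReal} [Fact (1 ≤ q)]

/-- The derivative of the `ℓ^q` norm away from the origin, in the form needed for flexes: a line
through `a ≠ 0` is stationary for the norm to first order iff its direction is annihilated by the
signed power of `a`. -/
lemma isLittleO_norm_add_smul_iff (hq : 1 < q.toReal) {a : LqSpace d q} (ha : a ≠ 0)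
    (b : LqSpace d q) :
    ((fun t : ℝ => ‖a + t • b‖ - ‖a‖) =o[𝓝 0] fun t : ℝ => t) ↔
      ∑ i, signedPow (q.toReal - 1) (a i) * b i = 0 := by
  obtain ⟨r, hr⟩ : ∃ r, r = q.toReal - 1 := ⟨_, rfl⟩
  have hr0 : 0 < r := by linarith
  have hq' : q.toReal = r + 1 := by linarith
  have hnorm : ∀ f : LqSpace d q, ‖f‖ = (∑ i, |f i| ^ (r + 1)) ^ (1 / (r + 1)) := fun f => by
    rw [PiLp.norm_eq_sum (by linarith), hq']; rfl
  have hpos : 0 < ∑ i, |a i| ^ (r + 1) := by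
    have h1 : 0 < ‖a‖ := norm_pos_iff.2 ha
    rw [hnorm] at h1
    refine lt_of_le_of_ne (Finset.sum_nonneg fun i _ => by positivity) fun h => ?_
    rw [← h, Real.zero_rpow (by positivity)] at h1
    exact lt_irrefl _ h1
  have hsum : HasDerivAt (fun t : ℝ => ∑ i, |a i + t * b i| ^ (r + 1))
      (∑ i, (r + 1) * signedPow r (a i) * b i) 0 := by
    refine HasDerivAt.fun_sum fun i _ => ?_
    have h1 : HasDerivAt (fun t : ℝ => a i + t * b i) (b i) 0 := by
      simpa using ((hasDerivAt_id (0 : ℝ)).mul_const (b i)).const_add (a i)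
    have h2 := hasDerivAt_abs_rpow_signedPow (a i + 0 * b i) hr0
    have h3 := HasDerivAt.comp (0 : ℝ) h2 h1
    simpa [Function.comp_def] using h3
  have hder := hsum.rpow_const (p := 1 / (r + 1)) (Or.inl (by simpa using hpos.ne'))
  have hfun : (fun t : ℝ => (∑ i, |a i + t * b i| ^ (r + 1)) ^ (1 / (r + 1))) =
      fun t : ℝ => ‖a + t • b‖ := by
    funext t
    rw [hnorm]
    rfl
  rw [hfun] at hder
  have hlit : ((fun t : ℝ => ‖a + t • b‖ - ‖a‖) =o[𝓝 0] fun t : ℝ => t) ↔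
      HasDerivAt (fun t : ℝ => ‖a + t • b‖) 0 0 := by
    rw [hasDerivAt_iff_isLittleO]
    simp
  have hfac : ∑ i, (r + 1) * signedPow r (a i) * b i =
      (r + 1) * ∑ i, signedPow r (a i) * b i := by
    rw [Finset.mul_sum]
    exact Finset.sum_congr rfl fun i _ => mul_assoc _ _ _
  rw [hlit, ← hr]
  constructor
  · intro h
    have h0 := hder.unique h
    simp only [zero_mul, add_zero, hfac] at h0
    have h1 : (∑ i, |a i| ^ (r + 1)) ^ (1 / (r + 1) - 1) ≠ 0 := (Real.rpow_pos_of_pos hpos _).ne'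
    have h2 : r + 1 ≠ 0 := by linarith
    exact (mul_eq_zero.1 ((mul_eq_zero.1 ((mul_eq_zero.1 h0).resolve_right h1)).resolve_right
      (one_div_ne_zero h2))).resolve_left h2
  · intro h
    rw [hfac, h] at hder
    simpa using hder

lemma isInfinitesimalFlex_iff {V : Type*} (hq : 1 < q.toReal) {G : SimpleGraph V}
    {p : V → LqSpace d q} (hp : IsPlacement G p) (u : V → LqSpace d q) :
    IsInfinitesimalFlex G p u ↔ ∀ v w, G.Adj v w →
      ∑ i, signedPow (q.toReal - 1) (p v i - p w i) * (u v i - u w i) = 0 := by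
  refine forall_congr' fun v => forall_congr' fun w => forall_congr' fun h => ?_
  have h1 := isLittleO_norm_add_smul_iff hq (sub_ne_zero.2 (hp h)) (u v - u w)
  have h2 : ∀ t : ℝ, p v + t • u v - (p w + t • u w) = p v - p w + t • (u v - u w) := fun t => by
    module
  simp only [h2]
  exact h1

/-! ### Infinitesimal rigid motions are translations -/

/-- The velocity field of a rigid motion preserves all distances to first order. -/
lemma IsInfinitesimalRigidMotion.isInfinitesimalFlex {X : Type*} [NormedAddCommGroup X]
    [NormedSpace ℝ X] {γ : X → X} (h : IsInfinitesimalRigidMotion γ) :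
    IsInfinitesimalFlex (⊤ : SimpleGraph X) id γ := by
  obtain ⟨Γ, hΓ, hd⟩ := h
  intro x y _
  have hx : ∀ x, (fun t : ℝ => x + t • γ x - Γ x t) =o[𝓝 0] fun t : ℝ => t := fun x => by
    have := (hasDerivAt_iff_isLittleO.1 (hd x)).neg_left
    simp only [sub_zero, hΓ.initial] at this
    refine this.congr_left fun t => ?_
    abel
  have hxy := (hx x).sub (hx y)
  refine IsLittleO.of_bound fun c hc => ?_
  filter_upwards [hxy.bound hc, Icc_mem_nhds (by norm_num : (-1 : ℝ) < 0) one_pos] with t ht htI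
  refine le_trans ?_ ht
  have h1 : ‖id x - id y‖ = ‖Γ x t - Γ y t‖ := by
    simpa [dist_eq_norm] using ((hΓ.isometry t htI).dist_eq x y).symm
  rw [h1, Real.norm_eq_abs]
  refine (abs_norm_sub_norm_le _ _).trans (le_of_eq ?_)
  congr 1
  simp only [id]
  abel

/-- For `q ≠ 2` every infinitesimal rigid motion of `ℓ^q` is constant. Preserving the distance
between points that differ in coordinate `i` only shows that `γ_i` does not depend on coordinate
`i`; between points that differ in coordinates `i` and `j`, it shows that `γ_i` depends on
coordinate `j` through a multiple of the signed power, and this is compatible with a change of the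
base point only if the multiple is zero or `2 ^ (q - 1) = 2`. -/
lemma IsInfinitesimalRigidMotion.eq_const (hq : 1 < q.toReal) (hq2 : q.toReal ≠ 2)
    {γ : LqSpace d q → LqSpace d q} (h : IsInfinitesimalRigidMotion γ) (x y : LqSpace d q) :
    γ x = γ y := by
  obtain ⟨r, hr⟩ : ∃ r, r = q.toReal - 1 := ⟨_, rfl⟩
  have hr0 : 0 < r := by linarith
  set g : (Fin d → ℝ) → Fin d → ℝ := fun z i => γ (WithLp.toLp q z) i with hg
  have hflex : ∀ x y : Fin d → ℝ, ∑ i, signedPow r (x i - y i) * (g x i - g y i) = 0 := by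
    intro x y
    by_cases hxy : x = y
    · simp [hxy]
    have hp : IsPlacement (⊤ : SimpleGraph (LqSpace d q)) id := fun v w hvw => hvw.ne
    have := (isInfinitesimalFlex_iff hq hp γ).1 h.isInfinitesimalFlex (WithLp.toLp q x)
      (WithLp.toLp q y)
      (by simpa [SimpleGraph.top_adj] using hxy)
    rw [← hr] at this
    simpa using this
  have hself : ∀ x i a, g (x + Pi.single i a) i = g x i := by
    intro x i a
    rcases eq_or_ne a 0 with rfl | ha
    · simp
    have h1 := hflex (x + Pi.single i a) x
    rw [Finset.sum_eq_single i (fun j _ hj => by simp [hj, signedPow_zero]) (by simp)] at h1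
    have h2 : signedPow r a ≠ 0 := by
      rw [← signedPow_zero r]
      exact (strictMono_signedPow hr0).injective.ne ha
    simpa [h2, sub_eq_zero] using h1
  have hpair : ∀ x i j, i ≠ j → ∀ a b, signedPow r a * (g (x + Pi.single j b) i - g x i) +
      signedPow r b * (g (x + Pi.single i a) j - g x j) = 0 := by
    intro x i j hij a b
    have h1 := hflex (x + Pi.single j b + Pi.single i a) x
    rw [Finset.sum_eq_add i j hij (fun k _ hk => by simp [hk.1, hk.2, signedPow_zero]) (by simp)
      (by simp), hself, add_right_comm x, hself] at h1
    simpa [hij, hij.symm] using h1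
  have hstep : ∀ x i j b, g (x + Pi.single j b) i = g x i := by
    intro x i j b
    by_cases hij : i = j
    · subst hij
      exact hself x i b
    -- `c x` is the multiple of the signed power by which `g · i` varies along coordinate `j`.
    set c : (Fin d → ℝ) → ℝ := fun x => g (x + Pi.single j 1) i - g x i with hc
    have h1 : signedPow r 1 = 1 := by simp [signedPow_of_pos]
    have hF : ∀ x b, g (x + Pi.single j b) i - g x i = signedPow r b * c x := by
      intro x b
      have e1 := hpair x i j hij 1 b
      have e2 := hpair x i j hij 1 1
      rw [h1] at e1 e2
      simp only [hc]
      linear_combination e1 - signedPow r b * e2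
    have e1 := hF (x + Pi.single j 1) (-1)
    have e2 := hF (x + Pi.single j 1) 1
    have e3 := hF x 2
    rw [signedPow_neg, h1] at e1
    rw [h1] at e2
    rw [add_assoc, ← Pi.single_add] at e1 e2
    norm_num at e1 e2
    rw [signedPow_of_pos r two_pos] at e3
    have e4 : (2 ^ r - 2) * c x = 0 := by
      have : c x = g (x + Pi.single j 1) i - g x i := rfl
      linear_combination e2 + e1 - e3 - 2 * this
    have h2 : (2 : ℝ) ^ r - 2 ≠ 0 := by
      intro h0
      have h3 : (2 : ℝ) ^ r = 2 ^ (1 : ℝ) := by rw [Real.rpow_one]; linarith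
      have h4 := (Real.strictMono_rpow_of_base_gt_one one_lt_two).injective h3
      exact hq2 (by linarith)
    have h3 := hF x b
    rw [(mul_eq_zero.1 e4).resolve_left h2, mul_zero] at h3
    linarith
  have hall : ∀ (x z : Fin d → ℝ) (i : Fin d) (t : Finset (Fin d)),
      g (x + ∑ j ∈ t, Pi.single j (z j)) i = g x i := by
    intro x z i t
    induction t using Finset.induction_on with
    | empty => simp
    | insert j t hj ih =>
      rw [Finset.sum_insert hj, add_comm (Pi.single j (z j) : Fin d → ℝ), ← add_assoc, hstep, ih]
  ext i
  have h1 := hall y.ofLp (x.ofLp - y.ofLp) i Finset.univ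
  rw [Finset.univ_sum_single, add_sub_cancel] at h1
  simpa [hg] using h1

lemma isInfinitesimalRigidMotion_const {X : Type*} [NormedAddCommGroup X] [NormedSpace ℝ X]
    (c : X) : IsInfinitesimalRigidMotion fun _ : X => c := by
  refine ⟨fun x t => x + t • c, ⟨fun t _ => ?_, fun x => ?_, fun x => by simp⟩, fun x => ?_⟩
  · exact Isometry.of_dist_eq fun x y => by simp
  · fun_prop
  · simpa using ((hasDerivAt_id (0 : ℝ)).smul_const c).const_add x

/-- For `q ≠ 2`, a framework in `ℓ^q` is infinitesimally rigid iff the linear equations of the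
rigidity matrix have constant solutions only. -/
lemma isInfinitesimallyRigid_iff {V : Type*} (hq : 1 < q.toReal) (hq2 : q.toReal ≠ 2)
    {G : SimpleGraph V} {p : V → LqSpace d q} :
    IsInfinitesimallyRigid G p ↔ IsPlacement G p ∧ ∀ u : V → Fin d → ℝ,
      (∀ v w, G.Adj v w →
        ∑ i, signedPow (q.toReal - 1) (p v i - p w i) * (u v i - u w i) = 0) →
      ∀ v w, u v = u w := by
  refine and_congr_right fun hp => ⟨fun h u hu v w => ?_, fun h u hu => ?_⟩
  · obtain ⟨γ, hγ, hγu⟩ := h (fun v => WithLp.toLp q (u v))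
      ((isInfinitesimalFlex_iff hq hp _).2 hu)
    have h1 := (hγu v).trans ((hγ.eq_const hq hq2 _ _).trans (hγu w).symm)
    simpa using h1
  · rcases isEmpty_or_nonempty V with hV | ⟨⟨v0⟩⟩
    · exact ⟨_, isInfinitesimalRigidMotion_const 0, fun v => hV.elim v⟩
    · refine ⟨_, isInfinitesimalRigidMotion_const (u v0), fun v => ?_⟩
      have := h (fun v => (u v).ofLp) ((isInfinitesimalFlex_iff hq hp u).1 hu) v v0
      exact WithLp.ofLp_injective q this

end Flexes

/-! ### Systems of bars between translating bodies -/

section Bars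

variable {B ι : Type*} {d : ℕ}

open Classical in
/-- The velocity vector `b` placed in the block of the body `k`, linearly in `b`. -/
def bodyVec (k : B) : (Fin d → ℝ) →ₗ[ℝ] (B × Fin d → ℝ) where
  toFun b c := if c.1 = k then b c.2 else 0
  map_add' b b' := by ext c; simp only [Pi.add_apply]; split_ifs <;> ring
  map_smul' a b := by
    ext c; simp only [Pi.smul_apply, smul_eq_mul, RingHom.id_apply]; split_ifs <;> ring

/-- The coefficient vector, in the coordinates of velocities `u : B → ℝ^d`, of the equation
`b ⬝ (u k - u l) = 0` that a bar between the bodies `k` and `l` imposes. It is linear in `b`. -/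
def barRow (k l : B) : (Fin d → ℝ) →ₗ[ℝ] (B × Fin d → ℝ) := bodyVec k - bodyVec l

open Classical in
lemma barRow_apply (k l : B) (b : Fin d → ℝ) (c : B × Fin d) :
    barRow k l b c = (if c.1 = k then b c.2 else 0) - if c.1 = l then b c.2 else 0 :=
  rfl

lemma barRow_dotProduct [Fintype B] (k l : B) (b : Fin d → ℝ) (u : B × Fin d → ℝ) :
    barRow k l b ⬝ᵥ u = ∑ i, b i * (u (k, i) - u (l, i)) := by
  classical
  simp only [dotProduct, barRow_apply, sub_mul, ite_mul, zero_mul,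
    Finset.sum_sub_distrib, Fintype.sum_prod_type_right, Finset.sum_ite_eq', Finset.mem_univ,
    if_true, mul_sub]

lemma barRow_self (k : B) : (barRow k k : (Fin d → ℝ) →ₗ[ℝ] _) = 0 := sub_self _

lemma barRow_swap (k l : B) (b : Fin d → ℝ) : barRow l k b = barRow k l (-b) := by
  rw [map_neg]
  exact (neg_sub _ _).symm

lemma barRow_add (k l m : B) : (barRow k l + barRow l m : (Fin d → ℝ) →ₗ[ℝ] _) = barRow k m :=
  sub_add_sub_cancel _ _ _

/-- The bars joining the bodies `k e` and `l e` with coefficient vectors `b e` leave the bodies no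
relative velocity: every solution of all their equations is constant. -/
def IsStiff (k l : ι → B) (b : ι → Fin d → ℝ) : Prop :=
  ∀ u : B → Fin d → ℝ, (∀ e, ∑ i, b e i * (u (k e) i - u (l e) i) = 0) → ∀ x y, u x = u y

/-- Constant velocities solve the equations of all bars, so the rank of a system of bars is at most
`d |B| - d`, with equality iff the constants are the only solutions. -/
lemma finrank_span_barRow_le_and_isStiff_iff [Finite B] [Nonempty B] [Finite ι]
    (k l : ι → B) (b : ι → Fin d → ℝ) :
    Module.finrank ℝ (Submodule.span ℝ (Set.range fun e => barRow (k e) (l e) (b e))) + d ≤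
        Nat.card B * d ∧
      (IsStiff k l b ↔
        Module.finrank ℝ (Submodule.span ℝ (Set.range fun e => barRow (k e) (l e) (b e))) + d =
          Nat.card B * d) := by
  classical
  have := Fintype.ofFinite B
  have := Fintype.ofFinite ι
  set M : Matrix ι (B × Fin d) ℝ := Matrix.of fun e => barRow (k e) (l e) (b e) with hM
  have hrank : Module.finrank ℝ
      (Submodule.span ℝ (Set.range fun e => barRow (k e) (l e) (b e))) =
      Module.finrank ℝ (LinearMap.range M.mulVecLin) := M.rank_eq_finrank_span_row.symm
  have hker : Module.finrank ℝ (LinearMap.range M.mulVecLin) +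
      Module.finrank ℝ (LinearMap.ker M.mulVecLin) = Nat.card B * d := by
    rw [M.mulVecLin.finrank_range_add_finrank_ker]
    simp
  have hmem : ∀ u : B × Fin d → ℝ, u ∈ LinearMap.ker M.mulVecLin ↔
      ∀ e, ∑ i, b e i * (u (k e, i) - u (l e, i)) = 0 := by
    intro u
    rw [LinearMap.mem_ker, Matrix.mulVecLin_apply, funext_iff]
    refine forall_congr' fun e => ?_
    rw [← barRow_dotProduct]
    rfl
  let K : (Fin d → ℝ) →ₗ[ℝ] (B × Fin d → ℝ) := LinearMap.funLeft ℝ ℝ Prod.snd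
  have hK : Function.Injective K :=
    LinearMap.funLeft_injective_of_surjective _ _ _ Prod.snd_surjective
  have hKd : Module.finrank ℝ (LinearMap.range K) = d := by
    rw [LinearMap.finrank_range_of_inj hK]; simp
  have hle : LinearMap.range K ≤ LinearMap.ker M.mulVecLin := by
    rintro _ ⟨z, rfl⟩
    rw [hmem]
    intro e
    simp [K, LinearMap.funLeft_apply]
  have hdim := Submodule.finrank_mono hle
  have hstiff : IsStiff k l b ↔ LinearMap.ker M.mulVecLin ≤ LinearMap.range K := by
    constructor
    · intro h u hu
      have h1 := h (fun x i => u (x, i)) ((hmem u).1 hu)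
      refine ⟨fun i => u (Classical.arbitrary B, i), ?_⟩
      ext c
      exact congrFun (h1 _ _) c.2
    · intro h u hu x y
      obtain ⟨z, hz⟩ := h ((hmem fun c => u c.1 c.2).2 hu)
      ext i
      exact (congrFun hz (x, i)).symm.trans (congrFun hz (y, i))
  refine ⟨by omega, ?_⟩
  rw [hstiff]
  constructor
  · intro h
    have := Submodule.finrank_mono h
    omega
  · intro h
    exact (Submodule.eq_of_le_of_finrank_eq hle (by omega)).ge

lemma isStiff_of_le_finrank [Finite B] [Nonempty B] [Finite ι] {k l : ι → B} {b : ι → Fin d → ℝ}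
    (h : Nat.card B * d ≤
      Module.finrank ℝ (Submodule.span ℝ (Set.range fun e => barRow (k e) (l e) (b e))) + d) :
    IsStiff k l b :=
  (finrank_span_barRow_le_and_isStiff_iff k l b).2.2
    ((finrank_span_barRow_le_and_isStiff_iff k l b).1.antisymm h)

lemma IsStiff.finrank_span [Finite B] [Nonempty B] [Finite ι] {k l : ι → B} {b : ι → Fin d → ℝ}
    (h : IsStiff k l b) :
    Module.finrank ℝ (Submodule.span ℝ (Set.range fun e => barRow (k e) (l e) (b e))) + d =
      Nat.card B * d :=
  (finrank_span_barRow_le_and_isStiff_iff k l b).2.1 h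

/-- Independent bars among the bodies of a set `C` number at most `d |C| - d`. -/
lemma LinearIndependent.card_bars_le [Finite B] [Finite ι] {k l : ι → B} {b : ι → Fin d → ℝ}
    (h : LinearIndependent ℝ fun e => barRow (k e) (l e) (b e)) (C : Set B) (hC : C.Nonempty)
    (hk : ∀ e, k e ∈ C) (hl : ∀ e, l e ∈ C) : Nat.card ι + d ≤ C.ncard * d := by
  classical
  have := Fintype.ofFinite ι
  have := hC.to_subtype
  let f : (C × Fin d → ℝ) →ₗ[ℝ] (B × Fin d → ℝ) :=
    { toFun := fun g c => if h : c.1 ∈ C then g (⟨c.1, h⟩, c.2) else 0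
      map_add' := fun g g' => by ext c; simp only [Pi.add_apply]; split_ifs <;> simp
      map_smul' := fun a g => by
        ext c; simp only [Pi.smul_apply, smul_eq_mul, RingHom.id_apply]; split_ifs <;> simp }
  have hf : ∀ e, f (barRow ⟨k e, hk e⟩ ⟨l e, hl e⟩ (b e)) = barRow (k e) (l e) (b e) := by
    intro e
    ext c
    simp only [f, barRow_apply, LinearMap.coe_mk, AddHom.coe_mk, Subtype.mk.injEq]
    by_cases hc : c.1 ∈ C
    · simp [hc]
    · have h1 : c.1 ≠ k e := fun h => hc (h ▸ hk e)
      have h2 : c.1 ≠ l e := fun h => hc (h ▸ hl e)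
      simp [hc, h1, h2]
  have h1 : LinearIndependent ℝ fun e => barRow (⟨k e, hk e⟩ : C) ⟨l e, hl e⟩ (b e) :=
    LinearIndependent.of_comp f (by simpa only [Function.comp_def, hf] using h)
  have h2 := (finrank_span_barRow_le_and_isStiff_iff (fun e => (⟨k e, hk e⟩ : C))
    (fun e => ⟨l e, hl e⟩) b).1
  rw [finrank_span_eq_card h1] at h2
  rwa [Nat.card_coe_set_eq, ← Nat.card_eq_fintype_card] at h2

end Bars

/-! ### Infinitesimal rigidity as a rank condition -/

section Rank

variable {V : Type*} {d : ℕ} {q : ENNReal}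

/-- The block of the rigidity matrix in the row of `e` and the columns of the first end of `e`. The
ends are ordered by `Quot.out`, as in `rigidityMatrix`. -/
def edgeVec (p : V → LqSpace d q) (e : Sym2 V) : Fin d → ℝ := fun i =>
  signedPow (q.toReal - 1) (p (Quot.out e).1 i - p (Quot.out e).2 i)

lemma signedPow_sum_eq_zero_iff (p : V → LqSpace d q) (u : V → Fin d → ℝ) (v w : V) :
    ∑ i, signedPow (q.toReal - 1) (p v i - p w i) * (u v i - u w i) = 0 ↔
      ∑ i, edgeVec p s(v, w) i *
        (u (Quot.out s(v, w)).1 i - u (Quot.out s(v, w)).2 i) = 0 := by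
  have h : s((Quot.out s(v, w)).1, (Quot.out s(v, w)).2) = s(v, w) := Quot.out_eq s(v, w)
  rcases Sym2.eq_iff.1 h with ⟨h1, h2⟩ | ⟨h1, h2⟩
  · simp only [edgeVec, h1, h2]
  · simp only [edgeVec, h1, h2]
    refine Eq.congr_left (Finset.sum_congr rfl fun i _ => ?_)
    rw [← neg_sub (p w i), signedPow_neg]
    ring

lemma isInfinitesimallyRigid_iff_isStiff [Fact (1 ≤ q)] (hq : 1 < q.toReal) (hq2 : q.toReal ≠ 2)
    {G : SimpleGraph V} {p : V → LqSpace d q} :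
    IsInfinitesimallyRigid G p ↔ IsPlacement G p ∧
      IsStiff (fun e : G.edgeSet => (Quot.out (e : Sym2 V)).1)
        (fun e : G.edgeSet => (Quot.out (e : Sym2 V)).2) fun e => edgeVec p e := by
  rw [isInfinitesimallyRigid_iff hq hq2]
  refine and_congr_right fun _ => forall_congr' fun u => imp_congr ⟨?_, ?_⟩ Iff.rfl
  · rintro h ⟨⟨v, w⟩, he⟩
    exact (signedPow_sum_eq_zero_iff p u v w).1 (h v w he)
  · intro h v w he
    exact (signedPow_sum_eq_zero_iff p u v w).2 (h ⟨s(v, w), he⟩)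

lemma eRank_rigidityMatrix [Finite V] (G : SimpleGraph V) (p : V → LqSpace d q) :
    (rigidityMatrix G p).eRank =
      Module.finrank ℝ (Submodule.span ℝ (Set.range fun e : G.edgeSet =>
        barRow (Quot.out (e : Sym2 V)).1 (Quot.out (e : Sym2 V)).2 (edgeVec p e))) := by
  classical
  have := Fintype.ofFinite V
  have hrow : (rigidityMatrix G p).row = fun e : G.edgeSet =>
      barRow (Quot.out (e : Sym2 V)).1 (Quot.out (e : Sym2 V)).2 (edgeVec p e) := by
    funext e c
    have hne : (Quot.out (e : Sym2 V)).1 ≠ (Quot.out (e : Sym2 V)).2 := by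
      have h1 : s((Quot.out (e : Sym2 V)).1, (Quot.out (e : Sym2 V)).2) = e := Quot.out_eq _
      have h2 := e.2
      rw [← h1] at h2
      exact G.ne_of_adj h2
    simp only [Matrix.row, rigidityMatrix, barRow_apply, edgeVec, signedPow]
    by_cases h1 : c.1 = (Quot.out (e : Sym2 V)).1
    · have h2 : c.1 ≠ (Quot.out (e : Sym2 V)).2 := fun h => hne (h1.symm.trans h)
      simp [h1, hne]
    · simp only [h1, if_false, zero_sub]
      split_ifs <;> simp
  have hfin : (rigidityMatrix G p).eRank ≠ ⊤ :=
    ne_top_of_le_ne_top (by rw [ENat.card_eq_coe_fintype_card]; exact ENat.natCast_ne_top _)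
      (rigidityMatrix G p).eRank_le_card_width
  rw [← hrow, ← Matrix.rank_eq_finrank_span_row, Matrix.rank_eq_finrank_span_cols,
    ← Matrix.eRank_toNat_eq_finrank, ENat.natCast_toNat hfin]

/-- If a graph has an infinitesimally rigid placement, then every regular placement of it is
infinitesimally rigid, since it has the same rank. -/
lemma IsRegularPlacement.isInfinitesimallyRigid [Finite V] [Nonempty V] [Fact (1 ≤ q)]
    (hq : 1 < q.toReal) (hq2 : q.toReal ≠ 2) {G : SimpleGraph V} {p p₀ : V → LqSpace d q}
    (hp : IsRegularPlacement G p) (hp₀ : IsInfinitesimallyRigid G p₀) :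
    IsInfinitesimallyRigid G p := by
  rw [isInfinitesimallyRigid_iff_isStiff hq hq2] at hp₀ ⊢
  refine ⟨hp.1, isStiff_of_le_finrank ?_⟩
  have h1 := hp.2 p₀ hp₀.1
  rw [eRank_rigidityMatrix, eRank_rigidityMatrix, Nat.cast_le] at h1
  rw [← hp₀.2.finrank_span]
  exact Nat.add_le_add_right h1 d

lemma IsInfinitesimallyRigid.comp_iso [Fact (1 ≤ q)] (hq : 1 < q.toReal) (hq2 : q.toReal ≠ 2)
    {W : Type*} {G : SimpleGraph V} {G' : SimpleGraph W} (f : G' ≃g G) {p : V → LqSpace d q}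
    (h : IsInfinitesimallyRigid G p) : IsInfinitesimallyRigid G' (p ∘ f) := by
  rw [isInfinitesimallyRigid_iff hq hq2] at h ⊢
  refine ⟨fun v w hvw => h.1 (f.map_adj_iff.2 hvw), fun u hu v w => ?_⟩
  have := h.2 (u ∘ f.symm) (fun v w hvw => by
    simpa using hu (f.symm v) (f.symm w) (f.symm.map_adj_iff.2 hvw)) (f v) (f w)
  simpa using this

/-- The quantifier over generic placements in `IsRigid` is redundant: the whole graph is a subgraph
of the complete graph, so that generic placements are regular for it. -/
lemma isRigid_iff_exists [Finite V] [Nonempty V] [Fact (1 ≤ q)] (hq : 1 < q.toReal)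
    (hq2 : q.toReal ≠ 2) {G : SimpleGraph V} :
    IsRigid d q G ↔ ∃ p : V → LqSpace d q, IsInfinitesimallyRigid G p := by
  refine ⟨fun h => h.1, fun h => ⟨h, fun p hp => ?_⟩⟩
  obtain ⟨p₀, hp₀⟩ := h
  let H : (⊤ : SimpleGraph V).Subgraph := SimpleGraph.Subgraph.mk Set.univ G.Adj
    (fun h => h.ne) (fun _ => trivial) G.symm
  let f : H.coe ≃g G := ⟨Equiv.Set.univ V, Iff.rfl⟩
  have : Nonempty H.verts := ⟨⟨Classical.arbitrary V, trivial⟩⟩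
  have h1 := (hp.2 H).isInfinitesimallyRigid hq hq2 (hp₀.comp_iso hq hq2 f)
  exact h1.comp_iso hq hq2 f.symm

/-- Infinitesimal rigidity is an open condition: a basis of the row space stays independent
under small perturbations of the placement. -/
lemma IsInfinitesimallyRigid.eventually [Finite V] [Nonempty V] [Fact (1 ≤ q)]
    (hq : 1 < q.toReal) (hq2 : q.toReal ≠ 2) {G : SimpleGraph V} {p₀ : V → LqSpace d q}
    (h : IsInfinitesimallyRigid G p₀) : ∀ᶠ p in 𝓝 p₀, IsInfinitesimallyRigid G p := by
  classical
  have := Fintype.ofFinite V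
  rw [isInfinitesimallyRigid_iff_isStiff hq hq2] at h
  obtain ⟨κ, a, ha, hspan, hli⟩ := exists_linearIndependent' ℝ fun e : G.edgeSet =>
    barRow (Quot.out (e : Sym2 V)).1 (Quot.out (e : Sym2 V)).2 (edgeVec p₀ e)
  have : Finite κ := Finite.of_injective a ha
  have := Fintype.ofFinite κ
  have hcont : Continuous fun (p : V → LqSpace d q) (e : κ) =>
      barRow (Quot.out (a e : Sym2 V)).1 (Quot.out (a e : Sym2 V)).2 (edgeVec p (a e)) := by
    refine continuous_pi fun e => (LinearMap.continuous_of_finiteDimensional _).comp ?_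
    refine continuous_pi fun i => (continuous_signedPow (by linarith)).comp ?_
    fun_prop
  have h1 : ∀ᶠ p in 𝓝 p₀, LinearIndependent ℝ fun e : κ =>
      barRow (Quot.out (a e : Sym2 V)).1 (Quot.out (a e : Sym2 V)).2 (edgeVec p (a e)) :=
    hcont.continuousAt.eventually hli.eventually
  have h2 : ∀ᶠ p in 𝓝 p₀, IsPlacement G p := by
    simp only [IsPlacement, eventually_all]
    intro v w hvw
    exact (isOpen_ne_fun (continuous_apply v) (continuous_apply w)).mem_nhds (h.1 hvw)
  filter_upwards [h1, h2] with p hp1 hp2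
  rw [isInfinitesimallyRigid_iff_isStiff hq hq2]
  refine ⟨hp2, isStiff_of_le_finrank ?_⟩
  rw [← h.2.finrank_span, ← hspan, finrank_span_eq_card hli, ← finrank_span_eq_card hp1]
  refine Nat.add_le_add_right (Submodule.finrank_mono (Submodule.span_mono ?_)) d
  rintro _ ⟨e, rfl⟩
  exact ⟨a e, rfl⟩

end Rank

/-! ### Independent transversals and sparse systems of bars -/

/-- Rado's theorem for finite sets of vectors: the sets `A e` have a linearly independent
transversal if any `n` of them span a space of dimension at least `n`. As long as some `A e` has
two elements, modularity of the dimension shows that one of the two may be deleted. -/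
theorem exists_linearIndependent_transversal {K W ι : Type*} [Field K] [AddCommGroup W] [Module K W]
    [FiniteDimensional K W] [Finite ι] (A : ι → Finset W)
    (hA : ∀ F : Finset ι,
      F.card ≤ Module.finrank K (F.sup fun e => Submodule.span K (A e : Set W) : Submodule K W)) :
    ∃ x : ι → W, (∀ e, x e ∈ A e) ∧ LinearIndependent K x := by
  classical
  have := Fintype.ofFinite ι
  induction hn : ∑ e, (A e).card using Nat.strong_induction_on generalizing A with
  | _ n ih =>
  subst hn
  by_cases hone : ∀ e, (A e).card ≤ 1
  · have hne : ∀ e, (A e).Nonempty := fun e => by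
      rw [Finset.nonempty_iff_ne_empty]
      intro h0
      have := hA {e}
      simp [h0] at this
    choose x hx using hne
    refine ⟨x, hx, linearIndependent_iff_card_le_finrank_span.2 ?_⟩
    refine (hA Finset.univ).trans (Submodule.finrank_mono (Finset.sup_le fun e _ => ?_))
    rw [Submodule.span_le]
    intro y hy
    rw [Finset.card_le_one.1 (hone e) y hy (x e) (hx e)]
    exact Submodule.subset_span ⟨e, rfl⟩
  push Not at hone
  obtain ⟨e, he⟩ := hone
  obtain ⟨x, hx, y, hy, hxy⟩ := Finset.one_lt_card.1 he
  -- Either a vector can be deleted from `A e`, or a set of indices obstructs its deletion.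
  have key : ∀ z ∈ A e, (∃ x : ι → W, (∀ e, x e ∈ A e) ∧ LinearIndependent K x) ∨
      ∃ F : Finset ι, e ∉ F ∧ Module.finrank K
        ((F.sup fun e => Submodule.span K (A e : Set W)) ⊔
          Submodule.span K ((A e).erase z : Set W) : Submodule K W) ≤ F.card := by
    intro z hz
    by_cases h : ∀ F : Finset ι, F.card ≤ Module.finrank K
        (F.sup fun e' => Submodule.span K
          (Function.update A e ((A e).erase z) e' : Set W) : Submodule K W)
    · left
      obtain ⟨x, hx, hli⟩ := ih _ (by
        refine Finset.sum_lt_sum (fun e' _ => ?_) ⟨e, Finset.mem_univ _, ?_⟩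
        · rcases eq_or_ne e' e with rfl | hne
          · simpa using Finset.card_erase_le
          · simp [hne]
        · simpa using Finset.card_erase_lt_of_mem hz) _ h rfl
      refine ⟨x, fun e' => ?_, hli⟩
      have := hx e'
      rcases eq_or_ne e' e with rfl | hne
      · rw [Function.update_self] at this
        exact Finset.mem_of_mem_erase this
      · rwa [Function.update_of_ne hne] at this
    · right
      push Not at h
      obtain ⟨F, hF⟩ := h
      have hsame : ∀ F : Finset ι, e ∉ F → (F.sup fun e' => Submodule.span K
          (Function.update A e ((A e).erase z) e' : Set W)) =
          F.sup fun e => Submodule.span K (A e : Set W) := fun F heF =>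
        Finset.sup_congr rfl fun e' he' => by
          rw [Function.update_of_ne (ne_of_mem_of_not_mem he' heF)]
      by_cases heF : e ∈ F
      · refine ⟨F.erase e, Finset.notMem_erase _ _, ?_⟩
        rw [← Finset.insert_erase heF, Finset.sup_insert, hsame _ (Finset.notMem_erase _ _),
          Function.update_self, Finset.card_insert_of_notMem (Finset.notMem_erase _ _)] at hF
        rw [sup_comm]
        exact Nat.lt_succ_iff.1 hF
      · rw [hsame F heF] at hF
        exact absurd (hA F) hF.not_ge
  rcases key x hx with h | ⟨F, heF, hF⟩
  · exact h
  rcases key y hy with h | ⟨F', heF', hF'⟩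
  · exact h
  exfalso
  set P := F.sup fun e => Submodule.span K (A e : Set W)
  set P' := F'.sup fun e => Submodule.span K (A e : Set W)
  set X := Submodule.span K ((A e).erase x : Set W)
  set Y := Submodule.span K ((A e).erase y : Set W)
  have h1 := Submodule.finrank_sup_add_finrank_inf_eq (P ⊔ X) (P' ⊔ Y)
  have h2 := hA (insert e (F ∪ F'))
  have h3 := hA (F ∩ F')
  have h4 : ((insert e (F ∪ F')).sup fun e => Submodule.span K (A e : Set W)) ≤
      (P ⊔ X) ⊔ (P' ⊔ Y) := by
    rw [Finset.sup_insert, Finset.sup_union]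
    refine sup_le ?_ (sup_le (le_sup_left.trans le_sup_left) (le_sup_left.trans le_sup_right))
    rw [Submodule.span_le]
    intro z hz
    by_cases hzx : z = x
    · exact (le_sup_right.trans le_sup_right : Y ≤ _)
        (Submodule.subset_span (Finset.mem_erase.2 ⟨hzx ▸ hxy, hz⟩))
    · exact (le_sup_right.trans le_sup_left : X ≤ _)
        (Submodule.subset_span (Finset.mem_erase.2 ⟨hzx, hz⟩))
  have h5 : ((F ∩ F').sup fun e => Submodule.span K (A e : Set W)) ≤ (P ⊔ X) ⊓ (P' ⊔ Y) :=
    le_inf ((Finset.sup_mono Finset.inter_subset_left).trans le_sup_left)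
      ((Finset.sup_mono Finset.inter_subset_right).trans le_sup_left)
  have h6 := Submodule.finrank_mono h4
  have h7 := Submodule.finrank_mono h5
  have h8 := Finset.card_union_add_card_inter F F'
  rw [Finset.card_insert_of_notMem (by simp [heF, heF'])] at h2
  omega

section Sparse

variable {B ι : Type*} {d : ℕ}

/-- In a sparse system, any `n` bars jointly span, over all choices of their coefficient vectors, a
space of dimension at least `n`. Two bodies are equivalent if the span contains every bar between
them; modulo the span all bodies of a class are the same, which bounds the dimension below by
`d |B| - d m` with `m` the number of classes, and sparsity within the classes bounds the number of
bars by the same quantity. -/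
lemma card_le_finrank_sup_range_barRow [Finite B] (k l : ι → B)
    (hs : ∀ C : Set B, C.Nonempty → ∀ J : Finset ι, (∀ e ∈ J, k e ∈ C ∧ l e ∈ C) →
      J.card + d ≤ C.ncard * d) (F : Finset ι) :
    F.card ≤ Module.finrank ℝ (F.sup fun e => LinearMap.range (barRow (k e) (l e)) :
      Submodule ℝ (B × Fin d → ℝ)) := by
  classical
  have := Fintype.ofFinite B
  set S : Submodule ℝ (B × Fin d → ℝ) := F.sup fun e => LinearMap.range (barRow (k e) (l e))
  let r : Setoid B :=
    { r := fun x y => ∀ b : Fin d → ℝ, barRow x y b ∈ S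
      iseqv := ⟨fun x b => by simp [barRow_self], fun {x y} h b => by
          rw [barRow_swap]; exact h _, fun {x y z} h h' b => by
          rw [← barRow_add x y z]; exact S.add_mem (h b) (h' b)⟩ }
  have hr : ∀ e ∈ F, Quotient.mk r (k e) = Quotient.mk r (l e) := fun e he =>
    Quotient.sound fun b => (Finset.le_sup (f := fun e =>
      LinearMap.range (barRow (k e) (l e) : (Fin d → ℝ) →ₗ[ℝ] _)) he) ⟨b, rfl⟩
  let L : (Quotient r → Fin d → ℝ) →ₗ[ℝ] (B × Fin d → ℝ) :=
    ∑ κ, bodyVec (Quotient.out κ) ∘ₗ LinearMap.proj κ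
  have hL : ∀ κ b, L (Pi.single κ b) = bodyVec (Quotient.out κ) b := by
    intro κ b
    simp only [L, LinearMap.sum_apply, LinearMap.comp_apply, LinearMap.proj_apply]
    rw [Finset.sum_eq_single κ (fun κ' _ h => by simp [h]) (by simp), Pi.single_eq_same]
  have htop : S ⊔ LinearMap.range L = ⊤ := by
    refine eq_top_iff.2 fun u _ => ?_
    have hu : u = ∑ x, bodyVec x (fun i => u (x, i)) := by
      ext c
      simp [bodyVec, Finset.sum_apply]
    rw [hu]
    refine Submodule.sum_mem _ fun x _ => ?_
    have h1 : bodyVec x (fun i => u (x, i)) = barRow x (Quotient.out (Quotient.mk r x))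
        (fun i => u (x, i)) + bodyVec (Quotient.out (Quotient.mk r x)) fun i => u (x, i) := by
      simp [barRow]
    rw [h1, ← hL]
    exact Submodule.add_mem_sup (Setoid.symm' r (Quotient.mk_out x) _) ⟨_, rfl⟩
  have hdim : Nat.card B * d ≤ Module.finrank ℝ S + Nat.card (Quotient r) * d := by
    have h1 := Submodule.finrank_add_le_finrank_add_finrank S (LinearMap.range L)
    have h2 := LinearMap.finrank_range_le L
    rw [htop, finrank_top] at h1
    simp only [Module.finrank_fintype_fun_eq_card, Fintype.card_prod, Fintype.card_fin,
      Module.finrank_pi_fintype, Finset.sum_const, Finset.card_univ, smul_eq_mul] at h1 h2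
    simp only [Nat.card_eq_fintype_card]
    omega
  have hcard : F.card + Nat.card (Quotient r) * d ≤ Nat.card B * d := by
    have h1 : F.card = ∑ κ : Quotient r, (F.filter fun e => Quotient.mk r (k e) = κ).card :=
      Finset.card_eq_sum_card_fiberwise fun e _ => Finset.mem_univ _
    have h2 : Nat.card B = ∑ κ : Quotient r, {x | Quotient.mk r x = κ}.ncard := by
      rw [Nat.card_eq_fintype_card, ← Finset.card_univ,
        Finset.card_eq_sum_card_fiberwise (f := Quotient.mk r) (t := Finset.univ)
          fun e _ => Finset.mem_univ _]
      refine Finset.sum_congr rfl fun κ _ => ?_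
      rw [← Set.ncard_coe_finset]
      congr 1
      ext x
      simp
    have h3 : Nat.card (Quotient r) * d = ∑ κ : Quotient r, d := by simp
    rw [h1, h2, h3, ← Finset.sum_add_distrib, Finset.sum_mul]
    refine Finset.sum_le_sum fun κ _ => hs _ ⟨Quotient.out κ, Quotient.out_eq κ⟩ _ fun e he => ?_
    rw [Finset.mem_filter] at he
    exact ⟨he.2, (hr e he.1).symm.trans he.2⟩
  omega

/-- The bars of a sparse system become independent for a suitable choice of their coefficient
vectors in any prescribed spanning sets. -/
lemma exists_linearIndependent_barRow [Finite B] [Finite ι] (k l : ι → B)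
    (hs : ∀ C : Set B, C.Nonempty → ∀ J : Finset ι, (∀ e ∈ J, k e ∈ C ∧ l e ∈ C) →
      J.card + d ≤ C.ncard * d)
    (U : ι → Set (Fin d → ℝ)) (hU : ∀ e, Submodule.span ℝ (U e) = ⊤) :
    ∃ b : ι → Fin d → ℝ, (∀ e, b e ∈ U e) ∧
      LinearIndependent ℝ fun e => barRow (k e) (l e) (b e) := by
  classical
  have := Fintype.ofFinite B
  have hfin : ∀ e, ∃ T : Finset (Fin d → ℝ), (T : Set (Fin d → ℝ)) ⊆ U e ∧
      Submodule.span ℝ (T : Set (Fin d → ℝ)) = ⊤ := by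
    intro e
    obtain ⟨t, htU, ht, hli⟩ := exists_linearIndependent ℝ (U e)
    have htf : t.Finite := hli.setFinite
    exact ⟨htf.toFinset, by simpa using htU, by simpa [hU e] using ht⟩
  choose T hTU hT using hfin
  obtain ⟨x, hx, hli⟩ := exists_linearIndependent_transversal (K := ℝ)
    (fun e => (T e).image (barRow (k e) (l e))) (fun F => by
      have hsup : (F.sup fun e => Submodule.span ℝ
          (((T e).image (barRow (k e) (l e)) : Finset _) : Set (B × Fin d → ℝ))) =
          F.sup fun e => LinearMap.range (barRow (k e) (l e)) :=
        Finset.sup_congr rfl fun e _ => by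
          rw [Finset.coe_image, Submodule.span_image, hT, Submodule.map_top]
      rw [hsup]
      exact card_le_finrank_sup_range_barRow k l hs F)
  choose b hb hbx using fun e => Finset.mem_image.1 (hx e)
  exact ⟨b, fun e => hTU e (hb e), by simpa only [hbx] using hli⟩

end Sparse

/-! ### Multi-body graphs -/

section MultiBodyRigidity

variable {V : Type*} {d : ℕ} {q : ENNReal} {G : SimpleGraph V} {s : Setoid V}

lemma bodyBarGraph_isLink_out {e : Sym2 V} (he : e ∈ (bodyBarGraph G s).edgeSet) :
    (bodyBarGraph G s).IsLink e (Quotient.mk s (Quot.out e).1) (Quotient.mk s (Quot.out e).2) := by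
  obtain ⟨_, _, v, w, rfl, hvw, hs, -, -⟩ := he
  have h : s((Quot.out s(v, w)).1, (Quot.out s(v, w)).2) = s(v, w) := Quot.out_eq s(v, w)
  refine ⟨_, _, h.symm, ?_, ?_, rfl, rfl⟩ <;> rcases Sym2.eq_iff.1 h with ⟨h1, h2⟩ | ⟨h1, h2⟩ <;>
    rw [h1, h2]
  · exact hvw
  · exact hvw.symm
  · exact hs
  · exact fun h' => hs (Setoid.symm' s h')

lemma bodyBarGraph_adj_out {e : Sym2 V} (he : e ∈ (bodyBarGraph G s).edgeSet) :
    G.Adj (Quot.out e).1 (Quot.out e).2 ∧ ¬ s (Quot.out e).1 (Quot.out e).2 := by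
  obtain ⟨v, w, h, hvw, hs, h1, h2⟩ := bodyBarGraph_isLink_out he
  have h' : s((Quot.out e).1, (Quot.out e).2) = e := Quot.out_eq e
  constructor
  · rw [← SimpleGraph.mem_edgeSet, h', h]
    exact hvw
  · exact fun h3 => hs (Quotient.exact (h1.symm.trans ((Quotient.sound h3).trans h2)))

lemma mem_edgeSet_bodyBarGraph {v w : V} (h : G.Adj v w) (hs : ¬ s v w) :
    s(v, w) ∈ (bodyBarGraph G s).edgeSet :=
  ⟨_, _, v, w, rfl, h, hs, rfl, rfl⟩

lemma out_mem_of_le {M : Graph (Quotient s) (Sym2 V)} (hM : M ≤ bodyBarGraph G s) {e : Sym2 V}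
    (he : e ∈ M.edgeSet) : Quotient.mk s (Quot.out e).1 ∈ M.vertexSet ∧
      Quotient.mk s (Quot.out e).2 ∈ M.vertexSet := by
  have h := (hM.isLink_iff he).2 (bodyBarGraph_isLink_out (hM.edgeSet_mono he))
  exact ⟨h.left_mem, h.right_mem⟩

/-- Velocities that are constant on the bodies satisfy the equations of all edges inside the
bodies, so the bars of a rigid multi-body graph alone are stiff. -/
lemma IsInfinitesimallyRigid.isStiff_bodyBarGraph [Fact (1 ≤ q)] (hq : 1 < q.toReal)
    (hq2 : q.toReal ≠ 2) {p : V → LqSpace d q} (h : IsInfinitesimallyRigid G p) (s : Setoid V) :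
    IsStiff (fun e : (bodyBarGraph G s).edgeSet => Quotient.mk s (Quot.out (e : Sym2 V)).1)
      (fun e => Quotient.mk s (Quot.out (e : Sym2 V)).2) fun e => edgeVec p e := by
  rw [isInfinitesimallyRigid_iff hq hq2] at h
  intro u hu
  have h1 := h.2 (fun v => u (Quotient.mk s v)) (fun v w hvw => by
    by_cases hs : s v w
    · have : Quotient.mk s v = Quotient.mk s w := Quotient.sound hs
      simp [this]
    · exact (signedPow_sum_eq_zero_iff p (fun v => u (Quotient.mk s v)) v w).2
        (hu ⟨s(v, w), mem_edgeSet_bodyBarGraph hvw hs⟩))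
  exact fun x y => Quotient.inductionOn₂ x y h1

/-- A basis of the row space of the bars of a rigid multi-body graph is `(d, d)`-tight. -/
lemma IsInfinitesimallyRigid.exists_isTight [Finite V] [Nonempty V] [Fact (1 ≤ q)]
    (hq : 1 < q.toReal) (hq2 : q.toReal ≠ 2) {p : V → LqSpace d q}
    (h : IsInfinitesimallyRigid G p) (s : Setoid V) :
    ∃ H : Graph (Quotient s) (Sym2 V),
      H.IsSpanningSubgraph (bodyBarGraph G s) ∧ IsTight d d H := by
  have : Nonempty (Quotient s) := ‹Nonempty V›.map (Quotient.mk s)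
  have hst := (h.isStiff_bodyBarGraph hq hq2 s).finrank_span
  obtain ⟨κ, a, ha, hspan, hli⟩ := exists_linearIndependent' ℝ
    fun e : (bodyBarGraph G s).edgeSet => barRow (Quotient.mk s (Quot.out (e : Sym2 V)).1)
      (Quotient.mk s (Quot.out (e : Sym2 V)).2) (edgeVec p e)
  have : Finite κ := Finite.of_injective a ha
  have := Fintype.ofFinite κ
  rw [← hspan, finrank_span_eq_card hli, ← Nat.card_eq_fintype_card] at hst
  set I : Set (Sym2 V) := Set.range fun x => (a x : Sym2 V) with hI
  have hIE : I ⊆ (bodyBarGraph G s).edgeSet := by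
    rintro _ ⟨x, rfl⟩
    exact (a x).2
  set H := (bodyBarGraph G s).restrict I with hH
  have hHle : H ≤ bodyBarGraph G s := Graph.restrict_le
  have hHE : H.edgeSet = I := Set.inter_eq_right.2 hIE
  refine ⟨H, ⟨hHle, rfl⟩, fun M hM hV => ?_, ?_⟩
  · have hMle := hM.trans hHle
    have hg : ∀ e : M.edgeSet, ∃ x, (a x : Sym2 V) = e := fun e =>
      hHE.subset (hM.edgeSet_mono e.2)
    choose g hg using hg
    have hginj : Function.Injective g := fun e e' he =>
      Subtype.ext ((hg e).symm.trans ((congrArg (fun x => (a x : Sym2 V)) he).trans (hg e')))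
    have hli' : LinearIndependent ℝ fun e : M.edgeSet =>
        barRow (Quotient.mk s (Quot.out (e : Sym2 V)).1)
          (Quotient.mk s (Quot.out (e : Sym2 V)).2) (edgeVec p e) := by
      have := hli.comp g hginj
      simpa only [Function.comp_def, hg] using this
    have hC : M.vertexSet.Nonempty := Set.nonempty_of_ncard_ne_zero (by omega)
    have := hli'.card_bars_le M.vertexSet hC (fun e => (out_mem_of_le hMle e.2).1)
      (fun e => (out_mem_of_le hMle e.2).2)
    rw [Nat.card_coe_set_eq] at this
    zify at this
    linarith
  · have h1 : H.vertexSet.ncard = Nat.card (Quotient s) := Set.ncard_univ _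
    have h2 : H.edgeSet.ncard = Nat.card κ := by
      rw [hHE, hI, ← Nat.card_coe_set_eq]
      exact Nat.card_range_of_injective fun x y hxy => ha (Subtype.ext hxy)
    rw [h1, h2]
    zify at hst
    linarith

/-- A sparse subgraph of the body-bar graph satisfies the counts also for single bodies, because
bars join different bodies. -/
lemma IsSparse.card_add_le [Finite V] {H : Graph (Quotient s) (Sym2 V)}
    (hH : H.IsSpanningSubgraph (bodyBarGraph G s)) (hs : IsSparse d d H)
    (C : Set (Quotient s)) (hC : C.Nonempty) (J : Finset H.edgeSet)
    (hJ : ∀ e ∈ J, Quotient.mk s (Quot.out (e : Sym2 V)).1 ∈ C ∧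
      Quotient.mk s (Quot.out (e : Sym2 V)).2 ∈ C) : J.card + d ≤ C.ncard * d := by
  classical
  have hpos : 0 < C.ncard := hC.ncard_pos
  rcases (by omega : C.ncard = 1 ∨ 2 ≤ C.ncard) with h1 | h2
  · obtain ⟨k, rfl⟩ := Set.ncard_eq_one.1 h1
    have hJe : J = ∅ := Finset.eq_empty_of_forall_notMem fun e he => by
      obtain ⟨h3, h4⟩ := hJ e he
      exact (bodyBarGraph_adj_out (hH.le.edgeSet_mono e.2)).2 (Quotient.exact (h3.trans h4.symm))
    simp [hJe]
  · have hCV : C ⊆ H.vertexSet := by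
      rw [hH.vertexSet_eq]
      exact Set.subset_univ _
    have h3 := hs (H.induce C) (Graph.induce_le hCV) h2
    have h4 : (J.image ((↑) : H.edgeSet → Sym2 V) : Set (Sym2 V)) ⊆ (H.induce C).edgeSet := by
      intro e he
      obtain ⟨e, heJ, rfl⟩ := Finset.mem_image.1 (Finset.mem_coe.1 he)
      rw [Graph.edgeSet_induce]
      exact ⟨_, _, (hH.le.isLink_iff e.2).2 (bodyBarGraph_isLink_out (hH.le.edgeSet_mono e.2)),
        hJ e heJ⟩
    have h5 := Set.ncard_le_ncard h4 (Set.toFinite _)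
    rw [Set.ncard_coe_finset, Finset.card_image_of_injective _ Subtype.val_injective] at h5
    have h6 : (H.induce C).vertexSet = C := rfl
    rw [h6] at h3
    zify at h5 ⊢
    linarith

/-- The signed powers of the points of a non-empty open set span `ℝ^d`. -/
lemma span_signedPow_image_eq_top [Fact (1 ≤ q)] {r : ℝ} (hr : 0 < r) {U : Set (LqSpace d q)}
    (hU : IsOpen U) (hne : U.Nonempty) :
    Submodule.span ℝ ((fun (a : LqSpace d q) i => signedPow r (a i)) '' U) = ⊤ := by
  classical
  obtain ⟨a, ha⟩ := hne
  have hev : ∀ᶠ t : ℝ in 𝓝 0, ∀ i, a + t • WithLp.toLp q (Pi.single i (1 : ℝ)) ∈ U := by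
    refine eventually_all.2 fun i => ?_
    have hc : Continuous fun t : ℝ => a + t • WithLp.toLp q (Pi.single i (1 : ℝ)) := by fun_prop
    exact hc.continuousAt.eventually (hU.mem_nhds (by simpa using ha))
  obtain ⟨t, ht, ht0⟩ := ((hev.filter_mono nhdsWithin_le_nhds).and
    (self_mem_nhdsWithin : {(0 : ℝ)}ᶜ ∈ 𝓝[≠] 0)).exists
  have hsingle : ∀ i, Pi.single i (1 : ℝ) ∈
      Submodule.span ℝ ((fun (a : LqSpace d q) i => signedPow r (a i)) '' U) := by
    intro i
    have hne : signedPow r (a i + t) - signedPow r (a i) ≠ 0 :=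
      sub_ne_zero.2 ((strictMono_signedPow hr).injective.ne (by simpa using ht0))
    have h1 : (Pi.single i (1 : ℝ) : Fin d → ℝ) =
        (signedPow r (a i + t) - signedPow r (a i))⁻¹ •
          ((fun j => signedPow r ((a + t • WithLp.toLp q (Pi.single i (1 : ℝ)) : LqSpace d q) j)) -
            fun j => signedPow r (a j)) := by
      ext j
      rcases eq_or_ne j i with rfl | hj
      · simp [hne]
      · simp [hj]
    rw [h1]
    exact Submodule.smul_mem _ _ (Submodule.sub_mem _ (Submodule.subset_span ⟨_, ht i, rfl⟩)
      (Submodule.subset_span ⟨a, ha, rfl⟩))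
  refine eq_top_iff.2 fun u _ => ?_
  rw [pi_eq_sum_univ' u]
  exact Submodule.sum_mem _ fun i _ => Submodule.smul_mem _ _ (by
    convert hsingle i using 1)

/-- If the body-bar graph of a multi-body graph has a tight spanning subgraph, the multi-body
graph has an infinitesimally rigid placement. No two bars share an end, so a
placement with rigid bodies can be perturbed at one end of each bar until the bars of the tight
subgraph have independent rows. -/
lemma IsMultiBody.exists_isInfinitesimallyRigid [Finite V] [Fact (1 ≤ q)] (hd : 0 < d)
    (hq : 1 < q.toReal) (hq2 : q.toReal ≠ 2) (hG : IsMultiBody d q G s)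
    {H : Graph (Quotient s) (Sym2 V)} (hH : H.IsSpanningSubgraph (bodyBarGraph G s))
    (hT : IsTight d d H) : ∃ p : V → LqSpace d q, IsInfinitesimallyRigid G p := by
  classical
  have hnt : Nontrivial (LqSpace d q) := by
    refine ⟨0, WithLp.toLp q fun _ => 1, fun h => ?_⟩
    have := congrArg (fun x : LqSpace d q => x ⟨0, hd⟩) h
    simp at this
  choose P hP using fun k => (hG.body_isRigid k).1
  let p₀ : V → LqSpace d q := fun v => P (Quotient.mk s v) ⟨v, rfl⟩
  have hev : ∀ᶠ p in 𝓝 p₀, ∀ k : Quotient s, IsInfinitesimallyRigid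
      (G.induce {v | Quotient.mk s v = k}) fun v => p v := by
    refine eventually_all.2 fun k => ?_
    have : Nonempty {v | Quotient.mk s v = k} := ⟨⟨Quotient.out k, Quotient.out_eq k⟩⟩
    have hPk : P k = fun v : {v | Quotient.mk s v = k} => p₀ v := by
      funext ⟨v, hv⟩
      obtain rfl : Quotient.mk s v = k := hv
      rfl
    have hc : Continuous fun (p : V → LqSpace d q) (v : {v | Quotient.mk s v = k}) => p v := by
      fun_prop
    have hk := (hP k).eventually hq hq2
    rw [hPk] at hk
    exact hc.continuousAt.eventually hk
  have := Fintype.ofFinite V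
  obtain ⟨ε, hε, hball⟩ := Metric.eventually_nhds_iff.1 hev
  set E := (bodyBarGraph G s).edgeSet
  -- The bar `e` may be given any vector in `U e`; excluding `0` keeps the ends of `e` apart, also
  -- for the bars outside `H`.
  let U : E → Set (LqSpace d q) := fun e =>
    Metric.ball (p₀ (Quot.out (e : Sym2 V)).1 - p₀ (Quot.out (e : Sym2 V)).2) ε ∩ {0}ᶜ
  have hUo : ∀ e, IsOpen (U e) := fun e => Metric.isOpen_ball.inter isOpen_compl_singleton
  have hUne : ∀ e, (U e).Nonempty := fun e =>
    (dense_compl_singleton (0 : LqSpace d q)).inter_open_nonempty _ Metric.isOpen_ball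
      ⟨_, Metric.mem_ball_self hε⟩
  obtain ⟨b, hbU, hli⟩ := exists_linearIndependent_barRow
    (fun e : H.edgeSet => Quotient.mk s (Quot.out (e : Sym2 V)).1)
    (fun e => Quotient.mk s (Quot.out (e : Sym2 V)).2) (hT.1.card_add_le hH)
    (fun e => (fun (a : LqSpace d q) i => signedPow (q.toReal - 1) (a i)) ''
      U ⟨e, hH.le.edgeSet_mono e.2⟩)
    (fun e => span_signedPow_image_eq_top (by linarith) (hUo _) (hUne _))
  have hα : ∀ e : E, ∃ a ∈ U e, ∀ he : (e : Sym2 V) ∈ H.edgeSet,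
      (fun i => signedPow (q.toReal - 1) (a i)) = b ⟨e, he⟩ := by
    intro e
    by_cases he : (e : Sym2 V) ∈ H.edgeSet
    · obtain ⟨a, ha, hab⟩ := hbU ⟨e, he⟩
      exact ⟨a, ha, fun _ => hab⟩
    · obtain ⟨a, ha⟩ := hUne e
      exact ⟨a, ha, fun h => absurd h he⟩
  choose α hαU hαb using hα
  have hout : ∀ e : E, s((Quot.out (e : Sym2 V)).1, (Quot.out (e : Sym2 V)).2) = e :=
    fun e => Quot.out_eq _
  -- Since no vertex is an end of two bars, moving the first end of every bar moves each vertex at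
  -- most once and leaves the second ends in place.
  have hinj : Function.Injective fun e : E => (Quot.out (e : Sym2 V)).1 := by
    intro e e' he
    obtain ⟨h1, h2⟩ := bodyBarGraph_adj_out e.2
    obtain ⟨h1', h2'⟩ := bodyBarGraph_adj_out e'.2
    simp only at he
    rw [← he] at h1' h2'
    refine Subtype.ext ?_
    rw [← hout e, ← hout e', hG.adj_unique h1 h2 h1' h2', he]
  have hdisj : ∀ e : E, ¬ ∃ e' : E, (Quot.out (e' : Sym2 V)).1 = (Quot.out (e : Sym2 V)).2 := by
    rintro e ⟨e', he⟩
    obtain ⟨h1, h2⟩ := bodyBarGraph_adj_out e.2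
    obtain ⟨h1', h2'⟩ := bodyBarGraph_adj_out e'.2
    rw [he] at h1' h2'
    have h3 := hG.adj_unique h1.symm (fun h => h2 (Setoid.symm' s h)) h1' h2'
    have h4 : e = e' := Subtype.ext (by rw [← hout e, ← hout e', he, h3, Sym2.eq_swap])
    subst h4
    exact h1.ne he
  let p : V → LqSpace d q := Function.extend (fun e : E => (Quot.out (e : Sym2 V)).1)
    (fun e => p₀ (Quot.out (e : Sym2 V)).2 + α e) p₀
  have hp1 : ∀ e : E, p (Quot.out (e : Sym2 V)).1 = p₀ (Quot.out (e : Sym2 V)).2 + α e :=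
    fun e => hinj.extend_apply _ _ e
  have hp2 : ∀ e : E, p (Quot.out (e : Sym2 V)).2 = p₀ (Quot.out (e : Sym2 V)).2 :=
    fun e => Function.extend_apply' _ _ _ (hdisj e)
  have hp : ∀ e : E, p (Quot.out (e : Sym2 V)).1 - p (Quot.out (e : Sym2 V)).2 = α e := fun e => by
    rw [hp1, hp2, add_sub_cancel_left]
  have hbody : ∀ k : Quotient s, IsInfinitesimallyRigid
      (G.induce {v | Quotient.mk s v = k}) fun v => p v := by
    refine hball ((dist_pi_lt_iff hε).2 fun v => ?_)
    by_cases hv : ∃ e : E, (Quot.out (e : Sym2 V)).1 = v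
    · obtain ⟨e, rfl⟩ := hv
      have h1 := (hαU e).1
      rw [Metric.mem_ball, dist_eq_norm] at h1
      rw [hp1, dist_eq_norm]
      convert h1 using 2
      abel
    · have : p v = p₀ v := Function.extend_apply' _ _ _ hv
      rwa [this, dist_self]
  simp only [isInfinitesimallyRigid_iff hq hq2] at hbody
  refine ⟨p, (isInfinitesimallyRigid_iff hq hq2).2 ⟨fun v w hvw => ?_, fun u hu v₁ v₂ => ?_⟩⟩
  · by_cases hs : s v w
    · exact (hbody (Quotient.mk s w)).1 (v := ⟨v, Quotient.sound hs⟩) (w := ⟨w, rfl⟩) hvw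
    · have h1 := (hαU ⟨s(v, w), mem_edgeSet_bodyBarGraph hvw hs⟩).2
      rw [← hp, Set.mem_compl_iff, Set.mem_singleton_iff, sub_eq_zero] at h1
      rcases Sym2.eq_iff.1 (hout ⟨s(v, w), mem_edgeSet_bodyBarGraph hvw hs⟩) with
        ⟨h2, h3⟩ | ⟨h2, h3⟩
      · rwa [h2, h3] at h1
      · rw [h2, h3] at h1
        exact fun h => h1 h.symm
  · have : Nonempty (Quotient s) := ⟨Quotient.mk s v₁⟩
    have huc : ∀ v, u v = u (Quotient.out (Quotient.mk s v)) := fun v =>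
      (hbody (Quotient.mk s v)).2 (fun w => u w) (fun w w' h => hu w w' h) ⟨v, rfl⟩
        ⟨Quotient.out (Quotient.mk s v), Quotient.out_eq _⟩
    have hstiff : IsStiff (fun e : H.edgeSet => Quotient.mk s (Quot.out (e : Sym2 V)).1)
        (fun e => Quotient.mk s (Quot.out (e : Sym2 V)).2) b := by
      have := Fintype.ofFinite H.edgeSet
      refine isStiff_of_le_finrank ?_
      rw [finrank_span_eq_card hli, ← Nat.card_eq_fintype_card, Nat.card_coe_set_eq]
      have h1 := hT.2
      have h2 : H.vertexSet.ncard = Nat.card (Quotient s) := by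
        rw [hH.vertexSet_eq]
        exact Set.ncard_univ _
      rw [h2] at h1
      zify
      linarith
    rw [huc v₁, huc v₂]
    refine hstiff (fun k => u (Quotient.out k)) (fun e => ?_) _ _
    have heE := hH.le.edgeSet_mono e.2
    have h1 := hu _ _ (bodyBarGraph_adj_out heE).1
    rw [← hαb ⟨e, heE⟩ e.2, ← huc, ← huc]
    simp only [← hp ⟨e, heE⟩]
    exact h1

end MultiBodyRigidity

end

theorem theoremt {V : Type*} [Finite V] [Nonempty V] (d : ℕ) (hd : 2 ≤ d)
    (q : ENNReal) [Fact (1 ≤ q)] (hq : q ∈ Set.Ioo 1 2 ∪ Set.Ioo 2 ⊤)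
    (G : SimpleGraph V) (s : Setoid V) (hG : IsMultiBody d q G s) :
    IsRigid d q G ↔
      ∃ H : Graph (Quotient s) (Sym2 V),
        H.IsSpanningSubgraph (bodyBarGraph G s) ∧ IsTight d d H := by
  have hqtop : q ≠ ⊤ := by
    rintro rfl
    simp at hq
  have hq1 : 1 < q.toReal := by
    rw [← ENNReal.toReal_one]
    refine (ENNReal.toReal_lt_toReal (by simp) hqtop).2 ?_
    exact hq.elim (fun h => h.1) fun h => lt_trans (by norm_num) h.1
  have hq2 : q.toReal ≠ 2 := by
    intro h
    have h2 : q = 2 := by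
      rw [← ENNReal.ofReal_toReal hqtop, h]
      simp
    subst h2
    simp at hq
  rw [isRigid_iff_exists hq1 hq2]
  constructor
  · rintro ⟨p, hp⟩
    exact hp.exists_isTight hq1 hq2 s
  · rintro ⟨H, hH, hT⟩
    exact hG.exists_isInfinitesimallyRigid (by omega) hq1 hq2 hH hT
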